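/- Let $K$ be an arbitrary field, let $U$ be a finite-dimensional vector space over $K$, let $V$ be a linear subspace of $U$, and let $V^\star$ be the dual space of $V$. Let $\mathcal{L}_s(U,V^\star)$ be the space of all self-adjoint linear maps $f : U \to V^\star$, i.e. those with $f(x)[y]=f(y)[x]$ for all $x,y\in V$. For a linear subspace $\mathcal{S}$ of $\mathcal{L}_s(U,V^\star)$, a group homomorphism $F : \mathcal{S}\to V^\star$ (not assumed to be $K$-linear) is called range-compatible if $F(s)\in \operatorname{im}(s)$ for all $s\in\mathcal{S}$. A range-compatible homomorphism on $\mathcal{S}$ is called standard if it can be extended to a range-compatible homomorphism on the whole space $\mathcal{L}_s(U,V^\star)$. Theorem. Let $\mathcal{S}$ be a linear subspace of $\mathcal{L}_s(U,V^\star)$ whose codimension in $\mathcal{L}_s(U,V^\star)$ is at most $\dim V-2$. Then every range-compatible homomorphism on $\mathcal{S}$ is standard. -/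

import Mathlib

/-- The space `L_s(U, V*)` of self-adjoint linear maps from `U` to the dual of the subspace `V`
of `U`: those `f` with `f x y = f y x` for all `x, y` in `V`. -/
def selfAdjointOperators {K U : Type*} [Field K] [AddCommGroup U] [Module K U]
    (V : Submodule K U) : Submodule K (U →ₗ[K] Module.Dual K V) where
  carrier := {f | ∀ x y : V, f (x : U) y = f (y : U) x}
  zero_mem' := fun _ _ => rfl
  add_mem' := by
    intro f g hf hg x y
    simp only [LinearMap.add_apply, hf x y, hg x y]
  smul_mem' := by
    intro c f hf x y
    simp only [LinearMap.smul_apply, hf x y]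

/-- A map `F : S → W` on an operator space `S ⊆ L(U, W)` is range-compatible when `F s` belongs
to the range of `s` for every `s` in `S`. -/
def IsRangeCompatible {K U W : Type*} [Field K] [AddCommGroup U] [Module K U]
    [AddCommGroup W] [Module K W] (S : Submodule K (U →ₗ[K] W)) (F : S → W) : Prop :=
  ∀ s : S, F s ∈ LinearMap.range (s : U →ₗ[K] W)

/-- The codimension in the subspace `L` of a subspace `S` contained in `L`. -/
noncomputable def relCodim (K : Type*) {M : Type*} [Field K] [AddCommGroup M] [Module K M]
    (L S : Submodule K M) : ℕ :=
  Module.finrank K (L ⧸ S.submoduleOf L)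

/-- A group homomorphism `F : S → V*` on a subspace `S` of `L_s(U, V*)` is standard when it is
range-compatible and is the restriction to `S` of a range-compatible group homomorphism defined
on the whole of `L_s(U, V*)`. -/
def IsStandard {K U : Type*} [Field K] [AddCommGroup U] [Module K U] (V : Submodule K U)
    (S : Submodule K (U →ₗ[K] Module.Dual K V)) (hS : S ≤ selfAdjointOperators V)
    (F : S →+ Module.Dual K V) : Prop :=
  IsRangeCompatible S F ∧
    ∃ G : selfAdjointOperators V →+ Module.Dual K V,
      IsRangeCompatible (selfAdjointOperators V) G ∧
        ∀ s : S, G (Submodule.inclusion hS s) = F s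

/-! Replace operators by symmetric bilinear forms on `U`: restricting the second variable to `V`
maps these onto the self-adjoint operators, with kernel `symFormsVanishingOn V`. By duality,
range-compatibility becomes a local condition: `F s x = 0` whenever `x ∈ V` and `s x = 0`. The goal
is `F s x = s u x + α (s x x)` on `V`, with `α` root-linear, since such a formula makes sense on all
self-adjoint operators and is range-compatible there (`standardHom`).

The formula is proved by induction on `dim V` (`exists_standardForm`). If `a²` is not in `S` modulo
forms vanishing on `V`, passing to `V ∩ ker a` lowers the codimension, so the bound survives. Two
such hyperplanes give two formulas, compared on their intersection `W`, where the codimension is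
still less than `dim W`. Counting dimensions there identifies the data, except that over the field
with two elements the diagonal parts may differ; a third hyperplane `ker (a + b)` then decides. For
a plane `V` the bound leaves all forms modulo those vanishing on `V`, and an additive functional
equation gives the formula. -/

open Module

/-! ### Symmetric forms, their squares, and dimension counts. -/

/-- The symmetric bilinear forms on `U`. -/
def symForms (K U : Type*) [Field K] [AddCommGroup U] [Module K U] :
    Submodule K (U →ₗ[K] U →ₗ[K] K) where
  carrier := {s | ∀ x y, s x y = s y x}
  zero_mem' := fun _ _ => rfl
  add_mem' := by
    intro f g hf hg x y
    simp only [LinearMap.add_apply, hf x y, hg x y]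
  smul_mem' := by
    intro c f hf x y
    simp only [LinearMap.smul_apply, hf x y]

/-- The symmetric bilinear forms on `U` whose radical contains `V`. -/
def symFormsVanishingOn {K U : Type*} [Field K] [AddCommGroup U] [Module K U]
    (V : Submodule K U) : Submodule K (U →ₗ[K] U →ₗ[K] K) where
  carrier := {s | s ∈ symForms K U ∧ ∀ x ∈ V, s x = 0}
  zero_mem' := ⟨zero_mem _, fun _ _ => rfl⟩
  add_mem' := by
    rintro f g ⟨hf, hf'⟩ ⟨hg, hg'⟩
    exact ⟨add_mem hf hg, fun x hx => by simp [hf' x hx, hg' x hx]⟩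
  smul_mem' := by
    rintro c f ⟨hf, hf'⟩
    exact ⟨Submodule.smul_mem _ c hf, fun x hx => by simp [hf' x hx]⟩

/-- An additive map `α : K → K` is root-linear when `α (l ^ 2 * a) = l * α a`. -/
def IsRootLinear {K : Type*} [Field K] (α : K →+ K) : Prop :=
  ∀ l a : K, α (l * l * a) = l * α a

section

set_option maxSynthPendingDepth 3

variable {K U : Type*} [Field K] [AddCommGroup U] [Module K U]

/-- The symmetric square of a linear form. -/
def formSq (a : Dual K U) : U →ₗ[K] U →ₗ[K] K := a.smulRight a

/-- The symmetric product of two linear forms. -/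
def formMul (a b : Dual K U) : U →ₗ[K] U →ₗ[K] K := a.smulRight b + b.smulRight a

@[simp] theorem formSq_apply (a : Dual K U) (x y : U) : formSq a x y = a x * a y := by
  simp [formSq]

@[simp] theorem formMul_apply (a b : Dual K U) (x y : U) :
    formMul a b x y = a x * b y + b x * a y := by
  simp [formMul]

theorem formSq_mem (a : Dual K U) : formSq a ∈ symForms K U := fun x y => by
  simp [mul_comm]

theorem formMul_mem (a b : Dual K U) : formMul a b ∈ symForms K U := fun x y => by
  simp; ring

theorem symFormsVanishingOn_le (V : Submodule K U) : symFormsVanishingOn V ≤ symForms K U :=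
  fun _ h => h.1

theorem symFormsVanishingOn_antitone {V W : Submodule K U} (h : V ≤ W) :
    symFormsVanishingOn W ≤ symFormsVanishingOn V :=
  fun _ hs => ⟨hs.1, fun x hx => hs.2 x (h hx)⟩

theorem formSq_mem_vanishing {V : Submodule K U} {a : Dual K U} (h : ∀ x ∈ V, a x = 0) :
    formSq a ∈ symFormsVanishingOn V :=
  ⟨formSq_mem a, fun x hx => by ext y; simp [h x hx]⟩

/-- Take `l = -1`. Hence `α` is zero outside characteristic 2, and cross terms disappear, so that `x
↦ α (s x x)` is additive. -/
theorem IsRootLinear.two {α : K →+ K} (h : IsRootLinear α) (a : K) : α a + α a = 0 := by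
  have := h (-1) a
  simp at this
  linear_combination this

theorem exists_form_of_linearIndependent {ι : Type*} {v : ι → U} (hv : LinearIndependent K v)
    (c : ι → K) : ∃ f : Dual K U, ∀ i, f (v i) = c i := by
  obtain ⟨f, hf⟩ := LinearMap.exists_extend ((Basis.span hv).constr K c)
  refine ⟨f, fun i => ?_⟩
  have h1 := congrArg (fun g => g (Basis.span hv i)) hf
  simp only [Basis.constr_basis] at h1
  rw [← h1]
  simp [Basis.span_apply]

theorem formMul_mem_of_formSq_mem {T : Submodule K (U →ₗ[K] U →ₗ[K] K)}
    (hT : ∀ a : Dual K U, formSq a ∈ T) (a b : Dual K U) : formMul a b ∈ T := by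
  have : formMul a b = formSq (a + b) - formSq a - formSq b := by
    ext x y; simp; ring
  rw [this]
  exact T.sub_mem (T.sub_mem (hT _) (hT _)) (hT _)

theorem symForms_le_of_formSq_mem [FiniteDimensional K U] {T : Submodule K (U →ₗ[K] U →ₗ[K] K)}
    (hT : ∀ a : Dual K U, formSq a ∈ T) : symForms K U ≤ T := by
  intro s hs
  let b := Module.finBasis K U
  -- A new index `k` contributes one square and symmetrised products, which are polarised squares;
  -- nothing is divided by 2.
  have key : ∀ A : Finset (Fin (finrank K U)),
      ∑ i ∈ A, ∑ j ∈ A, s (b i) (b j) • (b.coord i).smulRight (b.coord j) ∈ T := by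
    intro A
    induction A using Finset.induction_on with
    | empty => simp
    | insert k A hk ih =>
      have : ∑ i ∈ insert k A, ∑ j ∈ insert k A,
            s (b i) (b j) • (b.coord i).smulRight (b.coord j)
          = (∑ i ∈ A, ∑ j ∈ A, s (b i) (b j) • (b.coord i).smulRight (b.coord j))
            + s (b k) (b k) • formSq (b.coord k)
            + ∑ i ∈ A, s (b i) (b k) • formMul (b.coord i) (b.coord k) := by
        simp only [Finset.sum_insert hk, Finset.sum_add_distrib, formMul, formSq, smul_add,
          hs (b k)]
        abel
      rw [this]
      exact add_mem (add_mem ih (T.smul_mem _ (hT _)))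
        (sum_mem fun i _ => T.smul_mem _ (formMul_mem_of_formSq_mem hT _ _))
  have h : s = ∑ i, ∑ j, s (b i) (b j) • (b.coord i).smulRight (b.coord j) := by
    refine b.ext fun i => b.ext fun j => ?_
    simp [LinearMap.sum_apply, Finsupp.single_apply]
  rw [h]
  exact key _

theorem finrank_le_inf_ker_add_one [FiniteDimensional K U] (V : Submodule K U) (a : Dual K U) :
    finrank K V ≤ finrank K (V ⊓ LinearMap.ker a : Submodule K U) + 1 := by
  have h1 := LinearMap.finrank_range_add_finrank_ker (a.domRestrict V)
  have h2 : finrank K (LinearMap.range (a.domRestrict V)) ≤ 1 :=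
    (Submodule.finrank_le _).trans (by simp)
  have h3 : finrank K (LinearMap.ker (a.domRestrict V))
      = finrank K (V ⊓ LinearMap.ker a : Submodule K U) := by
    rw [LinearMap.ker_domRestrict, ← Submodule.finrank_map_subtype_eq,
      Submodule.map_comap_subtype]
  omega

theorem finrank_inf_ker_lt [FiniteDimensional K U] {V : Submodule K U} {a : Dual K U} {x : U}
    (hx : x ∈ V) (hax : a x ≠ 0) :
    finrank K (V ⊓ LinearMap.ker a : Submodule K U) < finrank K V := by
  refine Submodule.finrank_lt_finrank_of_lt (lt_of_le_of_ne inf_le_left fun h => hax ?_)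
  exact (h.ge hx).2

/-- A space of symmetric forms killed by a linear map that sends the symmetric forms onto `K ^ ι`
has codimension at least `card ι`. -/
theorem finrank_add_card_le [FiniteDimensional K U] {ι : Type*} [Fintype ι]
    {T : Submodule K (U →ₗ[K] U →ₗ[K] K)} (hT : T ≤ symForms K U)
    (θ : (U →ₗ[K] U →ₗ[K] K) →ₗ[K] ι → K) (hθ : ∀ s ∈ T, θ s = 0)
    (hsurj : ∀ c, ∃ s ∈ symForms K U, θ s = c) :
    finrank K T + Fintype.card ι ≤ finrank K (symForms K U) := by
  have h1 := LinearMap.finrank_range_add_finrank_ker (K := K) (V := symForms K U)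
    (V₂ := ι → K) (θ.domRestrict (symForms K U))
  have h2 : LinearMap.range (θ.domRestrict (symForms K U)) = ⊤ := by
    rw [LinearMap.range_eq_top]
    intro c
    obtain ⟨s, hs, h⟩ := hsurj c
    exact ⟨⟨s, hs⟩, h⟩
  rw [h2, finrank_top, finrank_fintype_fun_eq_card] at h1
  have h3 : finrank K T ≤ finrank K (LinearMap.ker (θ.domRestrict (symForms K U))) := by
    rw [← Submodule.finrank_map_subtype_eq (symForms K U)]
    refine Submodule.finrank_mono fun s hs => ?_
    exact ⟨⟨s, hT hs⟩, hθ s hs, rfl⟩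
  omega

end

/-! ### An additive functional equation. -/

/-- The additive functions governing a range-compatible map on symmetric `2 × 2` matrices. -/
theorem isRootLinear_of_additive_identity {K : Type*} [Field K] (p q r t : K →+ K)
    (hE : ∀ l d : K, p (l * l * d) + l * t d = q (l * d) + l * r (l * d))
    (hq : q 1 = 0) (hr : r 1 = 0) :
    (∀ d, q d = 0) ∧ (∀ d, r d = 0) ∧ (∀ d, t d = p d) ∧ IsRootLinear p := by
  -- Substituting `l⁻¹` for `l` shows that the identity is symmetric under `p ↔ t`, `q ↔ r`.
  have hE' : ∀ l d : K, t (l * l * d) + l * p d = r (l * d) + l * q (l * d) := by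
    intro l d
    by_cases hl : l = 0
    · simp [hl]
    have h := hE l⁻¹ (l * l * d)
    have e1 : l⁻¹ * l⁻¹ * (l * l * d) = d := by field_simp
    have e2 : l⁻¹ * (l * l * d) = l * d := by field_simp
    rw [e1, e2] at h
    field_simp at h
    rw [pow_two] at h
    linear_combination h
  have aux : ∀ p q r t : K →+ K,
      (∀ l d : K, p (l * l * d) + l * t d = q (l * d) + l * r (l * d)) → r 1 = 0 →
      ∀ d, r d = 0 := by
    intro p q r t h hr d
    -- Polarising in `l` removes the terms in `t` and `q`, which are additive in `l`. Two
    -- specialisations then give `2 p d = r d` and `2 p d = 2 r d`.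
    have pol : ∀ l m d : K, p (l * m * d) + p (l * m * d) = l * r (m * d) + m * r (l * d) := by
      intro l m d
      have h1 := h (l + m) d
      have e : (l + m) * (l + m) * d = l * l * d + l * m * d + l * m * d + m * m * d := by ring
      rw [e] at h1
      simp only [map_add, add_mul] at h1
      linear_combination h1 - h l d - h m d
    have h1 := pol d 1 1
    have h2 := pol 1 1 d
    simp only [mul_one, one_mul, hr, mul_zero, zero_add] at h1 h2
    linear_combination h1 - h2
  have r0 := aux p q r t hE hr
  have q0 := aux t r q p hE' hq
  have h : ∀ l d : K, p (l * l * d) + l * t d = 0 := fun l d => by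
    rw [hE, q0, r0]; simp
  have h1 : ∀ d, t d = p d := fun d => by
    have := h (-1) d
    simp at this
    linear_combination -this
  refine ⟨q0, r0, h1, fun l a => ?_⟩
  have e1 := h l a
  have e2 := h (-1) a
  have e3 := h 1 a
  simp at e2 e3
  rw [h1] at e1 e2 e3
  linear_combination e1 - l * e3

/-! ### Hyperplanes that preserve small codimension. -/

section

set_option maxSynthPendingDepth 3

variable {K U : Type*} [Field K] [AddCommGroup U] [Module K U]

/-- The restriction of `S` to `V` has codimension at most `dim V - 2`. -/
def SmallCodim (S : Submodule K (U →ₗ[K] U →ₗ[K] K)) (V : Submodule K U) : Prop :=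
  finrank K (symForms K U) + 2 ≤
    finrank K (S ⊔ symFormsVanishingOn V : Submodule K (U →ₗ[K] U →ₗ[K] K)) + finrank K V

/-- On `V`, the map `F` is the sum of evaluation at `u` and of the diagonal map given by `α`. -/
def HasStandardForm {S : Submodule K (U →ₗ[K] U →ₗ[K] K)} (F : S →+ Dual K U)
    (V : Submodule K U) (u : U) (α : K →+ K) : Prop :=
  IsRootLinear α ∧ ∀ s : S, ∀ x ∈ V, F s x = s.1 u x + α (s.1 x x)

/-- The form `a²` vanishes on `V ∩ ker a`, so it strictly enlarges the sum and pays for the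
dimension lost by `V`. -/
theorem smallCodim_inf_ker [FiniteDimensional K U] {S : Submodule K (U →ₗ[K] U →ₗ[K] K)}
    {V : Submodule K U} (hV : SmallCodim S V) {a : Dual K U}
    (ha : formSq a ∉ S ⊔ symFormsVanishingOn V) : SmallCodim S (V ⊓ LinearMap.ker a) := by
  unfold SmallCodim at *
  have h1 := finrank_le_inf_ker_add_one V a
  have h2 : S ⊔ symFormsVanishingOn V < S ⊔ symFormsVanishingOn (V ⊓ LinearMap.ker a) := by
    refine lt_of_le_of_ne (sup_le_sup_left (symFormsVanishingOn_antitone inf_le_left) _)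
      fun h => ha ?_
    rw [h]
    exact Submodule.mem_sup_right (formSq_mem_vanishing fun x hx => hx.2)
  have := Submodule.finrank_lt_finrank_of_lt h2
  omega

theorem smallCodim_of_symForms_le [FiniteDimensional K U]
    {S : Submodule K (U →ₗ[K] U →ₗ[K] K)} {V W : Submodule K U} (hWV : W ≤ V)
    (h : symForms K U ≤ S ⊔ symFormsVanishingOn V) (hW : 2 ≤ finrank K W) :
    SmallCodim S W := by
  have := Submodule.finrank_mono
    (h.trans (sup_le_sup_left (symFormsVanishingOn_antitone hWV) S))
  unfold SmallCodim
  omega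

theorem exists_independent_pair [FiniteDimensional K U]
    {T : Submodule K (U →ₗ[K] U →ₗ[K] K)} {V : Submodule K U}
    (hT : symFormsVanishingOn V ≤ T) (hV : 3 ≤ finrank K V) (h : ¬ symForms K U ≤ T) :
    ∃ a b : Dual K U, formSq a ∉ T ∧ formSq b ∉ T ∧ ∃ v ∈ V, ∃ w ∈ V,
      a v = 0 ∧ b v = 1 ∧ a w = 1 ∧ b w = 0 := by
  have ⟨a, ha⟩ : ∃ a : Dual K U, formSq a ∉ T := by
    by_contra! h'
    exact h (symForms_le_of_formSq_mem h')
  have ⟨x, hx, hax⟩ : ∃ x ∈ V, a x ≠ 0 := by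
    by_contra! h'
    exact ha (hT (formSq_mem_vanishing h'))
  have hH : 2 ≤ finrank K (V ⊓ LinearMap.ker a : Submodule K U) := by
    have := finrank_le_inf_ker_add_one V a
    omega
  obtain ⟨f, hf⟩ := exists_linearIndependent_of_le_finrank hH
  have hf' : LinearIndependent K (fun i => (f i : U)) :=
    hf.map' _ (Submodule.ker_subtype _)
  have hli : LinearIndependent K (Fin.cons ((a x)⁻¹ • x) (fun i => (f i : U)) : Fin 3 → U) := by
    rw [linearIndependent_finCons]
    refine ⟨hf', fun hmem => ?_⟩
    have : Submodule.span K (Set.range fun i => (f i : U)) ≤ LinearMap.ker a := by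
      rw [Submodule.span_le]
      rintro _ ⟨i, rfl⟩
      exact (f i).2.2
    have := this hmem
    simp [hax] at this
  obtain ⟨b, hb⟩ := exists_form_of_linearIndependent hli ![0, 1, 0]
  obtain ⟨c, hc⟩ := exists_form_of_linearIndependent hli ![0, 0, 1]
  have hb0 := hb 0
  have hb1 := hb 1
  have hb2 := hb 2
  have hc0 := hc 0
  have hc1 := hc 1
  have hc2 := hc 2
  have ha0 : a ((a x)⁻¹ • x) = 1 := by simp [hax]
  have ha1 : a (f 0 : U) = 0 := (f 0).2.2
  have ha2 : a (f 1 : U) = 0 := (f 1).2.2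
  have m0 : (a x)⁻¹ • x ∈ V := V.smul_mem _ hx
  have m1 : (f 0 : U) ∈ V := (f 0).2.1
  have m2 : (f 1 : U) ∈ V := (f 1).2.1
  change b ((a x)⁻¹ • x) = 0 at hb0
  change b (f 0) = 1 at hb1
  change b (f 1) = 0 at hb2
  change c ((a x)⁻¹ • x) = 0 at hc0
  change c (f 0) = 0 at hc1
  change c (f 1) = 1 at hc2
  generalize (a x)⁻¹ • x = e0 at *
  generalize (f 0 : U) = e1 at *
  generalize (f 1 : U) = e2 at *
  by_contra! hno
  -- If no partner of `a` exists, every form nonzero on `V ∩ ker a` has its square in `T`. The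
  -- identity below writes `a²` through such squares: each takes the value 1 at `e1` or `e2`, hence
  -- the need for dimension 3.
  have key : ∀ d : Dual K U, ∀ v ∈ V, a v = 0 → d v = 1 → formSq d ∈ T := by
    intro d v hv hav hdv
    by_contra hd
    refine hno a d ha hd v hv (e0 - d e0 • v) (V.sub_mem m0 (V.smul_mem _ hv)) hav hdv ?_ ?_
    · simp [hav, ha0]
    · simp [hdv]
  refine ha ?_
  have e : formSq a = formSq (a + b) + formSq (a + c) - formSq (a + b + c) + formSq (b + c)
      - formSq b - formSq c := by
    ext x y; simp; ring
  rw [e]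
  refine sub_mem (sub_mem (add_mem (sub_mem (add_mem ?_ ?_) ?_) ?_) ?_) ?_
  · exact key _ e1 m1 ha1 (by simp [*])
  · exact key _ e2 m2 ha2 (by simp [*])
  · exact key _ e1 m1 ha1 (by simp [*])
  · exact key _ e1 m1 ha1 (by simp [*])
  · exact key _ e1 m1 ha1 (by simp [*])
  · exact key _ e2 m2 ha2 (by simp [*])

/-- Two hyperplanes of `V` on which the codimension stays small. -/
theorem exists_smallCodim_pair [FiniteDimensional K U]
    {S : Submodule K (U →ₗ[K] U →ₗ[K] K)} {V : Submodule K U}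
    (hV : SmallCodim S V) (h3 : 3 ≤ finrank K V) :
    ∃ a b : Dual K U, SmallCodim S (V ⊓ LinearMap.ker a) ∧ SmallCodim S (V ⊓ LinearMap.ker b) ∧
      ∃ v ∈ V, ∃ w ∈ V, a v = 0 ∧ b v = 1 ∧ a w = 1 ∧ b w = 0 := by
  by_cases h : symForms K U ≤ S ⊔ symFormsVanishingOn V
  · have good : ∀ a : Dual K U, SmallCodim S (V ⊓ LinearMap.ker a) := fun a =>
      smallCodim_of_symForms_le inf_le_left h (by
        have := finrank_le_inf_ker_add_one V a
        omega)
    obtain ⟨f, hf⟩ := exists_linearIndependent_of_le_finrank ((by norm_num : 2 ≤ 3).trans h3)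
    have hf' : LinearIndependent K (fun i => (f i : U)) :=
      hf.map' _ (Submodule.ker_subtype _)
    obtain ⟨a, ha⟩ := exists_form_of_linearIndependent hf' ![0, 1]
    obtain ⟨b, hb⟩ := exists_form_of_linearIndependent hf' ![1, 0]
    exact ⟨a, b, good a, good b, f 0, (f 0).2, f 1, (f 1).2, ha 0, hb 0, ha 1, hb 1⟩
  · obtain ⟨a, b, ha, hb, r⟩ := exists_independent_pair le_sup_right h3 h
    exact ⟨a, b, smallCodim_inf_ker hV ha, smallCodim_inf_ker hV hb, r⟩

/-- The vector `v` makes `V` the sum of the two hyperplanes, and the cross term `2 α (s y z)` is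
zero. -/
theorem HasStandardForm.of_pair {S : Submodule K (U →ₗ[K] U →ₗ[K] K)}
    (hS : S ≤ symForms K U) {F : S →+ Dual K U} {V : Submodule K U} {a b : Dual K U}
    {u : U} {α : K →+ K}
    (ha : HasStandardForm F (V ⊓ LinearMap.ker a) u α)
    (hb : HasStandardForm F (V ⊓ LinearMap.ker b) u α)
    {v : U} (hv : v ∈ V) (hav : a v = 0) (hbv : b v = 1) : HasStandardForm F V u α := by
  refine ⟨ha.1, fun s x hx => ?_⟩
  have h1 := ha.2 s (b x • v) ⟨V.smul_mem _ hv, by simp [hav]⟩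
  have h2 := hb.2 s (x - b x • v) ⟨V.sub_mem hx (V.smul_mem _ hv), by simp [hbv]⟩
  have hx' : x = b x • v + (x - b x • v) := by abel
  generalize b x • v = y at *
  generalize x - y = z at *
  subst hx'
  rw [map_add, h1, h2]
  simp only [map_add, LinearMap.add_apply]
  have := ha.1.two (s.1 y z)
  rw [hS s.2 z y]
  linear_combination -this

/-! ### Comparing and gluing standard forms. -/

/-- The dimension bound on the intersection of two hyperplanes. -/
theorem SmallCodim.lt_of_inf [FiniteDimensional K U] {S : Submodule K (U →ₗ[K] U →ₗ[K] K)}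
    {V : Submodule K U} (hV : SmallCodim S V) (b : Dual K U) :
    finrank K (symForms K U) <
      finrank K (S ⊔ symFormsVanishingOn (V ⊓ LinearMap.ker b) :
        Submodule K (U →ₗ[K] U →ₗ[K] K)) + finrank K (V ⊓ LinearMap.ker b : Submodule K U) := by
  have h1 := finrank_le_inf_ker_add_one V b
  have h2 := Submodule.finrank_mono (sup_le_sup_left
    (symFormsVanishingOn_antitone (inf_le_left : V ⊓ LinearMap.ker b ≤ V)) S)
  unfold SmallCodim at hV
  omega

/-- Forms in `S` cannot all be killed by a linear map onto `K ^ (dim W)` that only depends on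
their restriction to `W × U`. -/
theorem false_of_surjective [FiniteDimensional K U] {S : Submodule K (U →ₗ[K] U →ₗ[K] K)}
    (hS : S ≤ symForms K U) {W : Submodule K U}
    (hW : finrank K (symForms K U) <
      finrank K (S ⊔ symFormsVanishingOn W : Submodule K (U →ₗ[K] U →ₗ[K] K)) + finrank K W)
    (θ : (U →ₗ[K] U →ₗ[K] K) →ₗ[K] Fin (finrank K W) → K) (h1 : ∀ s ∈ S, θ s = 0)
    (h2 : ∀ s ∈ symFormsVanishingOn W, θ s = 0)
    (hsurj : ∀ c, ∃ s ∈ symForms K U, θ s = c) : False := by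
  have := finrank_add_card_le (sup_le hS (symFormsVanishingOn_le W)) θ (fun s hs => by
    obtain ⟨s, hs', k, hk, rfl⟩ := Submodule.mem_sup.1 hs
    rw [map_add, h1 s hs', h2 k hk, add_zero]) hsurj
  rw [Fintype.card_fin] at this
  omega

theorem exists_form_of_basis (W : Submodule K U) [FiniteDimensional K W]
    (c : Fin (finrank K W) → K) :
    ∃ f : Dual K U, ∀ i, f (finBasis K W i) = c i :=
  exists_form_of_linearIndependent
    ((finBasis K W).linearIndependent.map' _ (Submodule.ker_subtype W)) c

/-- Evaluation at a nonzero vector does not vanish on a large space of symmetric forms. -/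
theorem eq_zero_of_forall_apply_eq_zero [FiniteDimensional K U]
    {S : Submodule K (U →ₗ[K] U →ₗ[K] K)} (hS : S ≤ symForms K U) {W : Submodule K U}
    (hW : finrank K (symForms K U) <
      finrank K (S ⊔ symFormsVanishingOn W : Submodule K (U →ₗ[K] U →ₗ[K] K)) + finrank K W)
    {w : U} (h : ∀ s ∈ S, ∀ x ∈ W, s w x = 0) : w = 0 := by
  by_contra hw
  have ⟨η, hη⟩ : ∃ η : Dual K U, η w = 1 := by
    obtain ⟨f, hf, -⟩ := Submodule.exists_le_ker_of_notMem (p := (⊥ : Submodule K U)) (v := w)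
      (by simpa using hw)
    exact ⟨(f w)⁻¹ • f, by simp [hf]⟩
  refine false_of_surjective hS hW
    (LinearMap.pi fun i => (LinearMap.applyₗ (finBasis K W i : U)).comp (LinearMap.applyₗ w))
    (fun s hs => ?_) (fun s hs => ?_) fun c => ?_
  · ext i
    simpa using h s hs _ (finBasis K W i).2
  · ext i
    simp [hs.1 w, hs.2 _ (finBasis K W i).2]
  · obtain ⟨ψ, hψ⟩ := exists_form_of_basis W c
    -- The multiple of `η²` cancels the unwanted term `ψ w * η x`, since `η` need not vanish on the
    -- basis of `W`.
    refine ⟨formMul η ψ - ψ w • formSq η, sub_mem (formMul_mem _ _)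
      (Submodule.smul_mem _ _ (formSq_mem _)), ?_⟩
    ext i
    simp [hψ, hη]

/-- A large space of symmetric forms contains a form that is not alternating on `W`. -/
theorem exists_apply_self_ne_zero [FiniteDimensional K U]
    {S : Submodule K (U →ₗ[K] U →ₗ[K] K)} (hS : S ≤ symForms K U) {W : Submodule K U}
    (hW : finrank K (symForms K U) <
      finrank K (S ⊔ symFormsVanishingOn W : Submodule K (U →ₗ[K] U →ₗ[K] K)) + finrank K W) :
    ∃ s ∈ S, ∃ x ∈ W, s x x ≠ 0 := by
  by_contra! h
  refine false_of_surjective hS hW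
    (LinearMap.pi fun i => (LinearMap.applyₗ (finBasis K W i : U)).comp
      (LinearMap.applyₗ (finBasis K W i : U)))
    (fun s hs => ?_) (fun s hs => ?_) fun c => ?_
  · ext i
    simpa using h s hs _ (finBasis K W i).2
  · ext i
    simp [hs.2 _ (finBasis K W i).2]
  · choose f hf using fun i => exists_form_of_basis W (Pi.single i 1)
    refine ⟨∑ i, c i • formSq (f i),
      sum_mem fun i _ => Submodule.smul_mem _ _ (formSq_mem _), ?_⟩
    ext i
    simp [hf, Pi.single_apply]

/-- If the forms in a large space satisfy `s w x = s x x` for `x ∈ W`, then `w ∈ W`. -/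
theorem mem_of_forall_apply_eq_apply_self [FiniteDimensional K U]
    {S : Submodule K (U →ₗ[K] U →ₗ[K] K)} (hS : S ≤ symForms K U) {W : Submodule K U}
    (hW : finrank K (symForms K U) <
      finrank K (S ⊔ symFormsVanishingOn W : Submodule K (U →ₗ[K] U →ₗ[K] K)) + finrank K W)
    {w : U} (h : ∀ s ∈ S, ∀ x ∈ W, s w x = s x x) : w ∈ W := by
  by_contra hw
  obtain ⟨f, hf, hfW⟩ := Submodule.exists_le_ker_of_notMem hw
  refine false_of_surjective hS hW
    (LinearMap.pi fun i => (LinearMap.applyₗ (finBasis K W i : U)).comp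
      (LinearMap.applyₗ w - LinearMap.applyₗ (finBasis K W i : U)))
    (fun s hs => ?_) (fun s hs => ?_) fun c => ?_
  · ext i
    simp [h s hs _ (finBasis K W i).2]
  · ext i
    simp [hs.1 w, hs.2 _ (finBasis K W i).2]
  · obtain ⟨ψ, hψ⟩ := exists_form_of_basis W c
    refine ⟨(f w)⁻¹ • formMul f ψ, Submodule.smul_mem _ _ (formMul_mem _ _), ?_⟩
    ext i
    have : f (finBasis K W i) = 0 := hfW (finBasis K W i).2
    simp [hψ, this, hf]

/-- Two standard forms on hyperplanes of `V` with the same diagonal part glue. -/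
theorem HasStandardForm.glue [FiniteDimensional K U] {S : Submodule K (U →ₗ[K] U →ₗ[K] K)}
    (hS : S ≤ symForms K U) {F : S →+ Dual K U} {V : Submodule K U} {a b : Dual K U}
    {u u' : U} {α : K →+ K} (hV : SmallCodim S (V ⊓ LinearMap.ker a))
    (ha : HasStandardForm F (V ⊓ LinearMap.ker a) u α)
    (hb : HasStandardForm F (V ⊓ LinearMap.ker b) u' α)
    {v : U} (hv : v ∈ V) (hav : a v = 0) (hbv : b v = 1) : HasStandardForm F V u α := by
  have : u - u' = 0 := by
    refine eq_zero_of_forall_apply_eq_zero hS (hV.lt_of_inf b) fun s hs x hx => ?_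
    have h1 := ha.2 ⟨s, hs⟩ x hx.1
    have h2 := hb.2 ⟨s, hs⟩ x ⟨hx.1.1, hx.2⟩
    rw [h1] at h2
    rw [map_sub, LinearMap.sub_apply]
    linear_combination h2
  obtain rfl := sub_eq_zero.1 this
  exact ha.of_pair hS hb hv hav hbv

/-- Over a field with more than two elements the diagonal parts agree. -/
theorem HasStandardForm.diagonal_unique [FiniteDimensional K U]
    {S : Submodule K (U →ₗ[K] U →ₗ[K] K)}
    (hS : S ≤ symForms K U) {F : S →+ Dual K U} {V : Submodule K U} {a b : Dual K U}
    {u u' : U} {α α' : K →+ K} (hV : SmallCodim S (V ⊓ LinearMap.ker a))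
    (ha : HasStandardForm F (V ⊓ LinearMap.ker a) u α)
    (hb : HasStandardForm F (V ⊓ LinearMap.ker b) u' α')
    {l : K} (hl0 : l ≠ 0) (hl1 : l ≠ 1) : α = α' := by
  obtain ⟨s, hs, x, hx, hsx⟩ := exists_apply_self_ne_zero hS (hV.lt_of_inf b)
  -- Scaling by `l²` multiplies the left side by `l²` but the right side by `l`, which forces both
  -- to vanish when `l ≠ 0, 1`.
  have key : ∀ c : K, c * s (u - u') x = (α' - α) (c * s x x) := by
    intro c
    have h1 := ha.2 ⟨c • s, S.smul_mem c hs⟩ x hx.1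
    have h2 := hb.2 ⟨c • s, S.smul_mem c hs⟩ x ⟨hx.1.1, hx.2⟩
    rw [h1] at h2
    simp only [LinearMap.smul_apply, smul_eq_mul] at h2
    rw [map_sub, LinearMap.sub_apply, AddMonoidHom.sub_apply]
    linear_combination h2
  have hroot : ∀ m c, (α' - α) (m * m * c) = m * (α' - α) c := by
    intro m c
    simp only [AddMonoidHom.sub_apply, ha.1 m c, hb.1 m c]
    ring
  have h1 : s (u - u') x = 0 := by
    have e := hroot l (s x x)
    rw [← key (l * l)] at e
    have e' := key 1
    rw [one_mul, one_mul] at e'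
    rw [← e'] at e
    have : l * (l - 1) * s (u - u') x = 0 := by linear_combination e
    simpa [hl0, sub_eq_zero, hl1] using this
  ext c
  have := key (c / s x x)
  rw [h1, mul_zero, div_mul_cancel₀ _ hsx, AddMonoidHom.sub_apply] at this
  linear_combination this

/-- Distinct diagonal parts on the kernels of `a` and `b` exclude `(a + b)²`. -/
theorem HasStandardForm.formSq_add_notMem {S : Submodule K (U →ₗ[K] U →ₗ[K] K)}
    {F : S →+ Dual K U} {V : Submodule K U} {a b : Dual K U}
    (hF : ∀ s : S, ∀ x ∈ V, s.1 x = 0 → F s x = 0)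
    {u u' : U} {α α' : K →+ K}
    (ha : HasStandardForm F (V ⊓ LinearMap.ker a) u α)
    (hb : HasStandardForm F (V ⊓ LinearMap.ker b) u' α')
    {v w : U} (hv : v ∈ V) (hw : w ∈ V) (hav : a v = 0) (hbv : b v = 1) (haw : a w = 1)
    (hbw : b w = 0) (hau : a (u - u') = 0) (hbu : b (u - u') = 0) (hα : α 1 ≠ α' 1) :
    formSq (a + b) ∉ S ⊔ symFormsVanishingOn V := by
  intro hmem
  obtain ⟨s, hs, k, hk, hsk⟩ := Submodule.mem_sup.1 hmem
  have hsV : ∀ x ∈ V, ∀ y, s x y = (a + b) x * (a + b) y := by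
    intro x hx y
    rw [← formSq_apply, ← hsk, LinearMap.add_apply, LinearMap.add_apply, hk.2 x hx]
    simp
  have hsV' : ∀ x ∈ V, ∀ y, s y x = (a + b) y * (a + b) x := by
    intro x hx y
    rw [← formSq_apply, ← hsk, LinearMap.add_apply, LinearMap.add_apply, hk.1 y x, hk.2 x hx]
    simp
  have h1 := ha.2 ⟨s, hs⟩ v ⟨hv, hav⟩
  have h2 := hb.2 ⟨s, hs⟩ w ⟨hw, hbw⟩
  -- Since `a + b` kills `v - w`, so does `s`; evaluating the two formulas at `v` and `w` then gives
  -- `α 1 = α' 1`.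
  have h3 := hF ⟨s, hs⟩ (v - w) (V.sub_mem hv hw) (by
    ext y
    rw [hsV _ (V.sub_mem hv hw)]
    simp [hav, hbv, haw, hbw])
  rw [map_sub, h1, h2] at h3
  simp only [hsV' v hv, hsV' w hw, LinearMap.add_apply, hav, hbv, haw, hbw, add_zero, zero_add,
    mul_one] at h3
  rw [map_sub] at hau hbu
  exact hα (by linear_combination h3 - hau - hbu)

/-- A range-compatible homomorphism on a space of small codimension has the standard form, if
this holds on the hyperplanes. -/
theorem exists_standardForm_of_hyperplanes [FiniteDimensional K U]
    {S : Submodule K (U →ₗ[K] U →ₗ[K] K)} (hS : S ≤ symForms K U) {F : S →+ Dual K U}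
    {V : Submodule K U} (hF : ∀ s : S, ∀ x ∈ V, s.1 x = 0 → F s x = 0)
    (hV : SmallCodim S V) (h3 : 3 ≤ finrank K V)
    (ih : ∀ a : Dual K U, (∃ x ∈ V, a x ≠ 0) → SmallCodim S (V ⊓ LinearMap.ker a) →
      ∃ u α, HasStandardForm F (V ⊓ LinearMap.ker a) u α) :
    ∃ u α, HasStandardForm F V u α := by
  obtain ⟨a, b, ha, hb, v, hv, w, hw, hav, hbv, haw, hbw⟩ := exists_smallCodim_pair hV h3
  obtain ⟨u, α, hu⟩ := ih a ⟨w, hw, by simp [haw]⟩ ha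
  obtain ⟨u', α', hu'⟩ := ih b ⟨v, hv, by simp [hbv]⟩ hb
  by_cases hα : α = α'
  · subst hα
    exact ⟨u, α, hu.glue hS ha hu' hv hav hbv⟩
  -- From here `K` has two elements, so additive maps are determined by their value at 1 and `α -
  -- α'` is the identity.
  have hK : ∀ l : K, l = 0 ∨ l = 1 := by
    intro l
    by_contra! hl
    exact hα (hu.diagonal_unique hS ha hu' hl.1 hl.2)
  have hext : ∀ β γ : K →+ K, β 1 = γ 1 → β = γ := by
    intro β γ h
    ext c
    obtain rfl | rfl := hK c
    · simp
    · exact h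
  have hα1 : α 1 ≠ α' 1 := fun h => hα (hext _ _ h)
  have h2 : (1 : K) + 1 = 0 := by
    obtain h | h := hK (1 + 1)
    · exact h
    · simp at h
  have hdiff : α - α' = AddMonoidHom.id K := by
    refine hext _ _ ?_
    obtain h | h := hK ((α - α') 1)
    · exact absurd (sub_eq_zero.1 h) hα1
    · exact h
  have hmem : u - u' ∈ V ⊓ LinearMap.ker a ⊓ LinearMap.ker b := by
    refine mem_of_forall_apply_eq_apply_self hS (ha.lt_of_inf b) fun s hs x hx => ?_
    have e1 := hu.2 ⟨s, hs⟩ x hx.1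
    have e2 := hu'.2 ⟨s, hs⟩ x ⟨hx.1.1, hx.2⟩
    have e3 : α (s x x) - α' (s x x) = s x x := by
      rw [← AddMonoidHom.sub_apply, hdiff, AddMonoidHom.id_apply]
    rw [e1] at e2
    rw [map_sub, LinearMap.sub_apply]
    linear_combination e2 - e3 - s x x * h2
  have hc := smallCodim_inf_ker hV
    (hu.formSq_add_notMem hF hu' hv hw hav hbv haw hbw hmem.1.2 hmem.2 hα1)
  obtain ⟨u₃, γ, h₃⟩ := ih (a + b) ⟨w, hw, by simp [haw, hbw]⟩ hc
  -- Only two additive maps exist, so the third hyperplane matches one of the first two and glues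
  -- with it.
  have hγ : γ = α ∨ γ = α' := by
    obtain h | h := hK (γ 1) <;> obtain h' | h' := hK (α 1) <;> obtain h'' | h'' := hK (α' 1) <;>
      first
      | exact Or.inl (hext _ _ (h.trans h'.symm))
      | exact Or.inr (hext _ _ (h.trans h''.symm))
      | exact absurd (h'.trans h''.symm) hα1
  obtain rfl | rfl := hγ
  · exact ⟨u, γ, hu.glue hS ha h₃ hv hav (by simp [hav, hbv])⟩
  · exact ⟨u', γ, hu'.glue hS hb h₃ hw hbw (by simp [haw, hbw])⟩

/-! ### The case of a plane. -/

/-- The additive map `c ↦ G (c • t) y`. -/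
def coeffHom (G : symForms K U →+ Dual K U) (t : symForms K U) (y : U) : K →+ K :=
  AddMonoidHom.mk' (fun c => G (c • t) y) fun c d => by
    rw [add_smul, map_add, LinearMap.add_apply]

theorem coeffHom_apply (G : symForms K U →+ Dual K U) (t : symForms K U) (y : U) (c : K) :
    coeffHom G t y c = G (c • t) y := rfl

/-- A form on `V × U`, for a plane `V`, decomposed along a basis of `V`. -/
theorem plane_decomposition {V : Submodule K U} {e₀ e₁ : U} {f₀ f₁ : Dual K U}
    (h₀₀ : f₀ e₀ = 1) (h₀₁ : f₀ e₁ = 0) (h₁₀ : f₁ e₀ = 0) (h₁₁ : f₁ e₁ = 1)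
    (hspan : ∀ x ∈ V, x = f₀ x • e₀ + f₁ x • e₁) (s : symForms K U) :
    ∃ φ ∈ V.dualAnnihilator, ∃ ψ ∈ V.dualAnnihilator, ∀ x ∈ V,
      s.1 x = (s.1 e₀ e₀ • formSq f₀ + s.1 e₀ e₁ • formMul f₀ f₁ + s.1 e₁ e₁ • formSq f₁
        + formMul f₀ φ + formMul f₁ ψ) x := by
  have hsym := s.2 e₁ e₀
  have mem : ∀ φ : Dual K U, φ e₀ = 0 → φ e₁ = 0 → φ ∈ V.dualAnnihilator := by
    intro φ h0 h1
    rw [Submodule.mem_dualAnnihilator]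
    intro x hx
    rw [hspan x hx]
    simp [h0, h1]
  have hφ := mem (s.1 e₀ - s.1 e₀ e₀ • f₀ - s.1 e₀ e₁ • f₁) (by simp [*]) (by simp [*])
  have hψ := mem (s.1 e₁ - s.1 e₀ e₁ • f₀ - s.1 e₁ e₁ • f₁) (by simp [*]) (by simp [*])
  refine ⟨_, hφ, _, hψ, fun x hx => ?_⟩
  have h1 := (Submodule.mem_dualAnnihilator _).1 hφ x hx
  have h2 := (Submodule.mem_dualAnnihilator _).1 hψ x hx
  have hs : s.1 x = f₀ x • s.1 e₀ + f₁ x • s.1 e₁ := by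
    conv_lhs => rw [hspan x hx]
    simp
  ext y
  rw [hs]
  simp only [LinearMap.add_apply, LinearMap.smul_apply, formSq_apply, formMul_apply, h1, h2,
    smul_eq_mul, LinearMap.sub_apply]
  ring

theorem exists_standardForm_of_plane_of_normalized [FiniteDimensional K U]
    {G : symForms K U →+ Dual K U}
    {V : Submodule K U} (hG : ∀ s : symForms K U, ∀ x ∈ V, s.1 x = 0 → G s x = 0)
    {e₀ e₁ : U} (he₀ : e₀ ∈ V) (he₁ : e₁ ∈ V) {f₀ f₁ : Dual K U}
    (h₀₀ : f₀ e₀ = 1) (h₀₁ : f₀ e₁ = 0) (h₁₀ : f₁ e₀ = 0) (h₁₁ : f₁ e₁ = 1)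
    (hspan : ∀ x ∈ V, x = f₀ x • e₀ + f₁ x • e₁)
    (hq : G ⟨formMul f₀ f₁, formMul_mem _ _⟩ e₀ = 0)
    (hr : G ⟨formMul f₀ f₁, formMul_mem _ _⟩ e₁ = 0)
    (hφ : ∀ φ ∈ V.dualAnnihilator, G ⟨formMul f₀ φ, formMul_mem _ _⟩ e₀ = 0)
    (hψ : ∀ φ ∈ V.dualAnnihilator, G ⟨formMul f₁ φ, formMul_mem _ _⟩ e₁ = 0) :
    ∃ α : K →+ K, IsRootLinear α ∧ ∀ s, ∀ x ∈ V, G s x = α (s.1 x x) := by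
  let Q₀ : symForms K U := ⟨formSq f₀, formSq_mem _⟩
  let Q₁ : symForms K U := ⟨formSq f₁, formSq_mem _⟩
  let M : symForms K U := ⟨formMul f₀ f₁, formMul_mem _ _⟩
  have z₁ : ∀ d : K, G (d • Q₁) e₀ = 0 := fun d => hG _ _ he₀ (by ext y; simp [Q₁, h₁₀])
  have z₀ : ∀ d : K, G (d • Q₀) e₁ = 0 := fun d => hG _ _ he₁ (by ext y; simp [Q₀, h₀₁])
  obtain ⟨q0, r0, tp, hp⟩ := isRootLinear_of_additive_identity (coeffHom G Q₀ e₀)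
    (coeffHom G M e₀) (coeffHom G M e₁) (coeffHom G Q₁ e₁) (by
      intro l d
      simp only [coeffHom_apply]
      -- This form is `d (l f₀ - f₁)²`, whose radical contains `e₀ + l e₁`.
      have h := hG ((l * l * d) • Q₀ - (l * d) • M + d • Q₁) (e₀ + l • e₁)
        (V.add_mem he₀ (V.smul_mem _ he₁)) (by
          ext y
          simp [Q₀, Q₁, M, h₀₀, h₀₁, h₁₀, h₁₁]
          ring)
      simp only [map_add, map_sub, map_smul, LinearMap.add_apply, LinearMap.sub_apply, z₀, z₁,
        smul_eq_mul] at h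
      linear_combination h)
    (by rw [coeffHom_apply, one_smul]; exact hq) (by rw [coeffHom_apply, one_smul]; exact hr)
  simp only [coeffHom_apply] at q0 r0 tp
  refine ⟨_, hp, fun s x hx => ?_⟩
  obtain ⟨φ, hφ', ψ, hψ', hs⟩ := plane_decomposition h₀₀ h₀₁ h₁₀ h₁₁ hspan s
  let A : symForms K U := ⟨formMul f₀ φ, formMul_mem _ _⟩
  let B : symForms K U := ⟨formMul f₁ ψ, formMul_mem _ _⟩
  have hA : G A e₁ = 0 := hG _ _ he₁ (by
    ext y; simp [A, h₀₁, (Submodule.mem_dualAnnihilator _).1 hφ' e₁ he₁])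
  have hB : G B e₀ = 0 := hG _ _ he₀ (by
    ext y; simp [B, h₁₀, (Submodule.mem_dualAnnihilator _).1 hψ' e₀ he₀])
  have hA' : G A e₀ = 0 := hφ φ hφ'
  have hB' : G B e₁ = 0 := hψ ψ hψ'
  have e : ∀ y ∈ V, G s y
      = G (s.1 e₀ e₀ • Q₀ + s.1 e₀ e₁ • M + s.1 e₁ e₁ • Q₁ + A + B) y := by
    intro y hy
    rw [← sub_eq_zero, ← LinearMap.sub_apply, ← map_sub]
    refine hG _ _ hy ?_
    have := hs y hy
    rw [← sub_eq_zero] at this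
    simpa [Q₀, Q₁, M, A, B] using this
  have E₀ : G s e₀ = coeffHom G Q₀ e₀ (s.1 e₀ e₀) := by
    rw [e _ he₀]
    simp only [map_add, LinearMap.add_apply, z₁, q0, hA', hB, coeffHom_apply, add_zero]
  have E₁ : G s e₁ = coeffHom G Q₀ e₀ (s.1 e₁ e₁) := by
    rw [e _ he₁]
    simp only [map_add, LinearMap.add_apply, z₀, r0, hA, hB', coeffHom_apply, add_zero, zero_add,
      tp]
  have hx' := hspan x hx
  generalize f₀ x = a at *
  generalize f₁ x = b at *
  subst hx'
  rw [map_add, map_smul, map_smul, E₀, E₁, smul_eq_mul, smul_eq_mul, ← hp, ← hp]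
  simp only [map_add, map_smul, LinearMap.add_apply, LinearMap.smul_apply, smul_eq_mul, mul_add]
  rw [s.2 e₁ e₀]
  have := hp.two (a * (b * s.1 e₀ e₁))
  rw [show b * (a * s.1 e₀ e₁) = a * (b * s.1 e₀ e₁) by ring, mul_assoc a a, mul_assoc b b]
  linear_combination -this

-- Subtracting evaluation at a suitable `u` reduces to the normalised case.
set_option maxHeartbeats 1000000 in
theorem exists_standardForm_of_plane_symForms [FiniteDimensional K U]
    {G : symForms K U →+ Dual K U}
    {V : Submodule K U} (hG : ∀ s : symForms K U, ∀ x ∈ V, s.1 x = 0 → G s x = 0)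
    (hV : finrank K V = 2) :
    ∃ u, ∃ α : K →+ K, IsRootLinear α ∧ ∀ s, ∀ x ∈ V, G s x = s.1 u x + α (s.1 x x) := by
  let b := finBasisOfFinrankEq K V hV
  have hli : LinearIndependent K (fun i => (b i : U)) :=
    b.linearIndependent.map' _ (Submodule.ker_subtype V)
  obtain ⟨f₀, hf₀⟩ := exists_form_of_linearIndependent hli ![1, 0]
  obtain ⟨f₁, hf₁⟩ := exists_form_of_linearIndependent hli ![0, 1]
  have h₀₀ := hf₀ 0
  have h₀₁ := hf₀ 1
  have h₁₀ := hf₁ 0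
  have h₁₁ := hf₁ 1
  change f₀ (b 0) = 1 at h₀₀
  change f₀ (b 1) = 0 at h₀₁
  change f₁ (b 0) = 0 at h₁₀
  change f₁ (b 1) = 1 at h₁₁
  have hspan : ∀ x ∈ V, x = f₀ x • (b 0 : U) + f₁ x • (b 1 : U) := by
    intro x hx
    have h := congrArg (Subtype.val) (b.sum_repr ⟨x, hx⟩)
    simp only [Fin.sum_univ_two, Submodule.coe_add, Submodule.coe_smul] at h
    have g₀ := congrArg f₀ h
    have g₁ := congrArg f₁ h
    simp only [map_add, map_smul, h₀₀, h₀₁, h₁₀, h₁₁, smul_eq_mul, mul_one, mul_zero, add_zero,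
      zero_add] at g₀ g₁
    rw [← g₀, ← g₁, h]
  have he₀ : (b 0 : U) ∈ V := (b 0).2
  have he₁ : (b 1 : U) ∈ V := (b 1).2
  generalize (b 0 : U) = e₀ at *
  generalize (b 1 : U) = e₁ at *
  have ann : ∀ φ ∈ V.dualAnnihilator, φ e₀ = 0 ∧ φ e₁ = 0 := fun φ hφ =>
    ⟨(Submodule.mem_dualAnnihilator _).1 hφ _ he₀, (Submodule.mem_dualAnnihilator _).1 hφ _ he₁⟩
  -- The form `(l f₀ - f₁) φ` has `e₀ + l e₁` in its radical. Comparison with `l = 1` makes `φ ↦ G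
  -- (f₀ φ) e₀` linear although `G` is only additive, so it is evaluation at a vector.
  have rel : ∀ l : K, ∀ φ ∈ V.dualAnnihilator,
      G ⟨formMul f₀ (l • φ), formMul_mem _ _⟩ e₀ = l * G ⟨formMul f₁ φ, formMul_mem _ _⟩ e₁ := by
    intro l φ hφ
    obtain ⟨z₀, z₁⟩ := ann φ hφ
    have h := hG (⟨formMul f₀ (l • φ), formMul_mem _ _⟩ - ⟨formMul f₁ φ, formMul_mem _ _⟩)
      (e₀ + l • e₁) (V.add_mem he₀ (V.smul_mem _ he₁)) (by
        ext y; simp [h₀₀, h₀₁, h₁₀, h₁₁, z₀, z₁])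
    have h' := hG ⟨formMul f₀ (l • φ), formMul_mem _ _⟩ e₁ he₁ (by
      ext y; simp [h₀₁, z₁])
    have h'' := hG ⟨formMul f₁ φ, formMul_mem _ _⟩ e₀ he₀ (by
      ext y; simp [h₁₀, z₀])
    simp only [map_add, map_sub, map_smul, LinearMap.sub_apply, h', h'',
      smul_eq_mul] at h
    linear_combination h
  let h : V.dualAnnihilator →ₗ[K] K :=
    { toFun := fun φ => G ⟨formMul f₀ φ, formMul_mem _ _⟩ e₀
      map_add' := by
        intro φ ψ
        rw [← LinearMap.add_apply, ← map_add]
        congr 2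
        ext x y
        simp
        ring
      map_smul' := by
        intro l φ
        have h1 := rel 1 φ φ.2
        rw [one_smul, one_mul] at h1
        simp only [Submodule.coe_smul, RingHom.id_apply, smul_eq_mul]
        rw [rel l φ φ.2, h1] }
  obtain ⟨ℓ, hℓ⟩ := LinearMap.exists_extend h
  obtain ⟨u₀, hu₀⟩ := (evalEquiv K U).surjective ℓ
  have hu₀' : ∀ φ ∈ V.dualAnnihilator, φ u₀ = G ⟨formMul f₀ φ, formMul_mem _ _⟩ e₀ := by
    intro φ hφ
    have := LinearMap.congr_fun hℓ ⟨φ, hφ⟩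
    rw [← hu₀] at this
    simpa [h] using this
  -- Corrections along `e₀`, `e₁` are invisible to the annihilator of `V` and serve to normalise the
  -- values on `f₀ f₁`.
  let u : U := u₀ + (G ⟨formMul f₀ f₁, formMul_mem _ _⟩ e₁ - f₀ u₀) • e₀
    + (G ⟨formMul f₀ f₁, formMul_mem _ _⟩ e₀ - f₁ u₀) • e₁
  have u0 : f₀ u = G ⟨formMul f₀ f₁, formMul_mem _ _⟩ e₁ := by
    simp [u, h₀₀, h₀₁]
  have u1 : f₁ u = G ⟨formMul f₀ f₁, formMul_mem _ _⟩ e₀ := by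
    simp [u, h₁₀, h₁₁]
  have uφ : ∀ φ ∈ V.dualAnnihilator, φ u = G ⟨formMul f₀ φ, formMul_mem _ _⟩ e₀ := by
    intro φ hφ
    simp [u, ann φ hφ, hu₀' φ hφ]
  clear_value u
  let G' : symForms K U →+ Dual K U := G -
    AddMonoidHom.mk' (fun s => s.1 u) (fun s t => rfl)
  have hG' : ∀ s y, G' s y = G s y - s.1 u y := fun _ _ => rfl
  obtain ⟨α, hα, H⟩ := exists_standardForm_of_plane_of_normalized (G := G') (V := V)
    (fun s x hx h => by rw [hG', hG s x hx h, s.2 u x, h]; simp) he₀ he₁ h₀₀ h₀₁ h₁₀ h₁₁ hspan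
    (by rw [hG', formMul_apply, h₀₀, h₁₀, u1]; ring)
    (by rw [hG', formMul_apply, h₀₁, h₁₁, u0]; ring)
    (fun φ hφ => by rw [hG', formMul_apply, h₀₀, (ann φ hφ).1, uφ φ hφ]; ring)
    (fun φ hφ => by
      have h1 := rel 1 φ hφ
      rw [one_mul, one_smul] at h1
      rw [hG', formMul_apply, h₁₁, (ann φ hφ).2, uφ φ hφ, h1]; ring)
  refine ⟨u, α, hα, fun s x hx => ?_⟩
  have := H s x hx
  rw [hG'] at this
  linear_combination this

/-- On `V`, `F s` depends only on `s` modulo forms vanishing on `V`, so a linear section carries `F`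
to all symmetric forms. -/
theorem exists_standardForm_of_plane [FiniteDimensional K U]
    {S : Submodule K (U →ₗ[K] U →ₗ[K] K)} (hS : S ≤ symForms K U) {F : S →+ Dual K U}
    {V : Submodule K U} (hF : ∀ s : S, ∀ x ∈ V, s.1 x = 0 → F s x = 0)
    (hV : SmallCodim S V) (h2 : finrank K V = 2) :
    ∃ u α, HasStandardForm F V u α := by
  have htop : S ⊔ symFormsVanishingOn V = symForms K U := by
    refine Submodule.eq_of_le_of_finrank_le (sup_le hS (symFormsVanishingOn_le V)) ?_
    unfold SmallCodim at hV
    omega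
  let π : S × symFormsVanishingOn V →ₗ[K] symForms K U :=
    (Submodule.inclusion hS).coprod (Submodule.inclusion (symFormsVanishingOn_le V))
  obtain ⟨g, hg⟩ := π.exists_rightInverse_of_surjective (by
    rw [LinearMap.range_eq_top]
    rintro ⟨s, hs⟩
    obtain ⟨t, ht, k, hk, rfl⟩ := Submodule.mem_sup.1 (htop.ge hs)
    exact ⟨(⟨t, ht⟩, ⟨k, hk⟩), rfl⟩)
  have hσ : ∀ s : symForms K U, ∀ x ∈ V, (g s).1.1 x = s.1 x := by
    intro s x hx
    have h := congrArg Subtype.val (LinearMap.congr_fun hg s)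
    change (g s).1.1 + (g s).2.1 = s.1 at h
    rw [← h, LinearMap.add_apply, (g s).2.2.2 x hx, add_zero]
  obtain ⟨u, α, hα, H⟩ := exists_standardForm_of_plane_symForms
    (G := F.comp ((LinearMap.fst K S (symFormsVanishingOn V)).comp g).toAddMonoidHom) (V := V)
    (fun s x hx h => hF _ x hx ((hσ s x hx).trans h)) h2
  refine ⟨u, α, hα, fun s x hx => ?_⟩
  have e := H ⟨s.1, hS s.2⟩ x hx
  rw [← e]
  have := hF (s - (g ⟨s.1, hS s.2⟩).1) x hx (by
    have := hσ ⟨s.1, hS s.2⟩ x hx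
    simp [this])
  rw [map_sub, LinearMap.sub_apply, sub_eq_zero] at this
  exact this

theorem exists_standardForm [FiniteDimensional K U]
    {S : Submodule K (U →ₗ[K] U →ₗ[K] K)} (hS : S ≤ symForms K U) {F : S →+ Dual K U}
    {V : Submodule K U} (hF : ∀ s : S, ∀ x ∈ V, s.1 x = 0 → F s x = 0)
    (hV : SmallCodim S V) : ∃ u α, HasStandardForm F V u α := by
  induction h : finrank K V using Nat.strong_induction_on generalizing V with
  | _ n ih =>
    have h2 : 2 ≤ finrank K V := by
      have := Submodule.finrank_mono (sup_le hS (symFormsVanishingOn_le V))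
      unfold SmallCodim at hV
      omega
    obtain h2 | h3 := h2.eq_or_lt
    · exact exists_standardForm_of_plane hS hF hV h2.symm
    · refine exists_standardForm_of_hyperplanes hS hF hV h3 fun a ⟨x, hx, hax⟩ ha => ?_
      exact ih _ (h ▸ finrank_inf_ker_lt hx hax) (fun s y hy => hF s y hy.1) ha rfl

/-! ### Transfer between symmetric forms and self-adjoint operators. -/

/-- Restriction of the second variable of a bilinear form to `V`. -/
def restrictForm (V : Submodule K U) : (U →ₗ[K] U →ₗ[K] K) →ₗ[K] (U →ₗ[K] Dual K V) :=
  LinearMap.compRight K (V.subtype.dualMap)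

@[simp] theorem restrictForm_apply (V : Submodule K U) (s : U →ₗ[K] U →ₗ[K] K) (u : U) (x : V) :
    restrictForm V s u x = s u x := rfl

theorem map_restrictForm_symForms (V : Submodule K U) :
    (symForms K U).map (restrictForm V) = selfAdjointOperators V := by
  apply le_antisymm
  · rintro _ ⟨s, hs, rfl⟩ x y
    exact hs x y
  · intro f hf
    obtain ⟨π, hπ⟩ := LinearMap.exists_leftInverse_of_injective V.subtype (Submodule.ker_subtype V)
    have hπ' : ∀ x : V, π x = x := fun x => LinearMap.congr_fun hπ x
    let B : U →ₗ[K] U →ₗ[K] K := LinearMap.compRight K (π.dualMap) f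
    have hB : ∀ x y, B x y = f x (π y) := fun _ _ => rfl
    -- The form `f x (π y) + f y (π x) - f (π x) (π y)`: for `y ∈ V` the last two terms cancel by
    -- self-adjointness.
    refine ⟨B + B.flip - B.compl₁₂ (V.subtype ∘ₗ π) LinearMap.id, fun x y => ?_, ?_⟩
    · have := hf (π x) (π y)
      simp only [LinearMap.sub_apply, LinearMap.add_apply, LinearMap.flip_apply,
        LinearMap.compl₁₂_apply, hB, LinearMap.comp_apply, Submodule.subtype_apply,
        LinearMap.id_apply, this]
      ring
    · ext u x
      have := hf (π u) x
      simp [hB, hπ', this]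

theorem symForms_inf_ker_restrictForm (V : Submodule K U) :
    symForms K U ⊓ LinearMap.ker (restrictForm V) = symFormsVanishingOn V := by
  ext s
  refine ⟨fun ⟨hs, h⟩ => ⟨hs, fun x hx => ?_⟩, fun ⟨hs, h⟩ => ⟨hs, ?_⟩⟩
  · ext y
    rw [hs x y]
    exact LinearMap.congr_fun (LinearMap.congr_fun h y) ⟨x, hx⟩
  · ext u x
    rw [restrictForm_apply, hs u x, h x x.2]
    rfl

theorem finrank_map_add_finrank_inf_ker {E E' : Type*} [AddCommGroup E] [Module K E]
    [FiniteDimensional K E] [AddCommGroup E'] [Module K E'] (f : E →ₗ[K] E')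
    (A : Submodule K E) :
    finrank K (A.map f) + finrank K (A ⊓ LinearMap.ker f : Submodule K E) = finrank K A := by
  have h := LinearMap.finrank_range_add_finrank_ker (f.domRestrict A)
  rw [LinearMap.range_domRestrict, LinearMap.ker_domRestrict, ← Submodule.finrank_map_subtype_eq,
    Submodule.map_comap_subtype] at h
  exact h

theorem relCodim_add_finrank {E : Type*} [AddCommGroup E] [Module K E] [FiniteDimensional K E]
    {L S : Submodule K E} (h : S ≤ L) : relCodim K L S + finrank K S = finrank K L := by
  rw [relCodim, ← Submodule.finrank_quotient_add_finrank (S.submoduleOf L),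
    (Submodule.submoduleOfEquivOfLe h).finrank_eq]

/-- The map `f ↦ f u + α (f · ·)` on self-adjoint operators. -/
def standardHom (V : Submodule K U) (u : U) {α : K →+ K} (hα : IsRootLinear α) :
    selfAdjointOperators V →+ Dual K V :=
  AddMonoidHom.mk' (fun f =>
    { toFun := fun x => f.1 u x + α (f.1 x x)
      map_add' := fun x y => by
        have := hα.two (f.1 x y)
        have h := f.2 y x
        simp only [Submodule.coe_add, map_add, LinearMap.add_apply, h]
        linear_combination this
      map_smul' := fun c x => by
        simp only [Submodule.coe_smul, map_smul, LinearMap.smul_apply, smul_eq_mul,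
          RingHom.id_apply]
        rw [← mul_assoc, hα]
        ring }) fun f g => by
    ext x
    simp only [Submodule.coe_add, LinearMap.add_apply, LinearMap.coe_mk, AddHom.coe_mk, map_add]
    ring

theorem standardHom_apply (V : Submodule K U) (u : U) {α : K →+ K} (hα : IsRootLinear α)
    (f : selfAdjointOperators V) (x : V) :
    standardHom V u hα f x = f.1 u x + α (f.1 x x) := rfl

theorem mem_range_of_forall_apply_eq_zero {V : Type*} [AddCommGroup V] [Module K V]
    [FiniteDimensional K V] {f : U →ₗ[K] Dual K V} {φ : Dual K V}
    (h : ∀ x, (∀ u, f u x = 0) → φ x = 0) : φ ∈ LinearMap.range f := by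
  rw [← Subspace.dualCoannihilator_dualAnnihilator_eq (W := LinearMap.range f),
    Submodule.mem_dualAnnihilator]
  intro x hx
  rw [Submodule.mem_dualCoannihilator] at hx
  exact h x fun u => hx _ ⟨u, rfl⟩

theorem isRangeCompatible_standardHom [FiniteDimensional K U] (V : Submodule K U) (u : U)
    {α : K →+ K} (hα : IsRootLinear α) :
    IsRangeCompatible (selfAdjointOperators V) (standardHom V u hα) := fun f =>
  mem_range_of_forall_apply_eq_zero fun x hx => by
    rw [standardHom_apply, hx, hx, map_zero, add_zero]

/-- Range-compatible homomorphisms on a space of self-adjoint operators of small codimension are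
standard. -/
theorem isStandard_of_relCodim_le [FiniteDimensional K U] (V : Submodule K U)
    (S : Submodule K (U →ₗ[K] Dual K V)) (hS : S ≤ selfAdjointOperators V)
    (hcodim : (relCodim K (selfAdjointOperators V) S : ℤ) ≤ (finrank K V : ℤ) - 2)
    (F : S →+ Dual K V) (hF : IsRangeCompatible S F) : IsStandard V S hS F := by
  refine ⟨hF, ?_⟩
  let R := restrictForm (K := K) V
  let T : Submodule K (U →ₗ[K] U →ₗ[K] K) := symForms K U ⊓ S.comap R
  have hTmap : T.map R = S := by
    apply le_antisymm
    · rintro _ ⟨s, hs, rfl⟩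
      exact hs.2
    · intro f hf
      obtain ⟨s, hs, rfl⟩ := (map_restrictForm_symForms V).ge (hS hf)
      exact ⟨s, ⟨hs, hf⟩, rfl⟩
  have hTker : T ⊓ LinearMap.ker R = symFormsVanishingOn V := by
    rw [← symForms_inf_ker_restrictForm V]
    refine le_antisymm (inf_le_inf_right _ inf_le_left) fun s hs => ⟨⟨hs.1, ?_⟩, hs.2⟩
    change R s ∈ S
    rw [show R s = 0 from hs.2]
    exact S.zero_mem
  -- `T` contains the kernel of restriction within the symmetric forms, so it has the same
  -- codimension as `S`.
  have hV : SmallCodim T V := by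
    have h1 := finrank_map_add_finrank_inf_ker R T
    have h2 := finrank_map_add_finrank_inf_ker R (symForms K U)
    rw [hTmap, hTker] at h1
    rw [map_restrictForm_symForms, symForms_inf_ker_restrictForm] at h2
    have h3 := relCodim_add_finrank hS
    have h4 : T ⊔ symFormsVanishingOn V = T := sup_eq_left.2 (hTker ▸ inf_le_left)
    unfold SmallCodim
    rw [h4]
    omega
  obtain ⟨π, hπ⟩ := LinearMap.exists_leftInverse_of_injective V.subtype (Submodule.ker_subtype V)
  let res : T →ₗ[K] S := R.restrict fun s hs => hs.2
  obtain ⟨u, α, hα, H⟩ := exists_standardForm (S := T) inf_le_left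
    (F := (π.dualMap.toAddMonoidHom.comp F).comp res.toAddMonoidHom) (V := V)
    (fun s x hx h => by
      obtain ⟨v, hv⟩ := hF (res s)
      change F (res s) (π x) = 0
      have : π x = ⟨x, hx⟩ := LinearMap.congr_fun hπ ⟨x, hx⟩
      rw [this, ← hv]
      change s.1 v x = 0
      rw [s.2.1 v x, h]
      rfl) hV
  refine ⟨standardHom V u hα, isRangeCompatible_standardHom V u hα, ?_⟩
  rintro ⟨f, hf⟩
  obtain ⟨s, hs, rfl⟩ := hTmap.ge hf
  ext x
  have h := H ⟨s, hs⟩ x x.2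
  change F (res ⟨s, hs⟩) (π x) = _ at h
  have : π x = x := LinearMap.congr_fun hπ x
  rw [this] at h
  rw [standardHom_apply]
  exact h.symm

end

theorem mainTheorem3 {K U : Type*} [Field K] [AddCommGroup U] [Module K U]
    [FiniteDimensional K U] (V : Submodule K U)
    (S : Submodule K (U →ₗ[K] Module.Dual K V)) (hS : S ≤ selfAdjointOperators V)
    (hcodim : (relCodim K (M := U →ₗ[K] Module.Dual K V) (selfAdjointOperators V) S : ℤ) ≤ (Module.finrank K V : ℤ) - 2)
    (F : S →+ Module.Dual K V) (hF : IsRangeCompatible S F) :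
    IsStandard V S hS F :=
  isStandard_of_relCodim_le V S hS hcodim F hF
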